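/- Let $p$ be a prime and let $G\cong\bigoplus_{i=1}^{s}G_i$ be a bounded abelian $p$-group, where $s\ge 1$, $G_i\cong(\mathbb Z_{p^{n_i}})^{(r_i)}$ is a direct sum of $r_i$ copies of $\mathbb Z_{p^{n_i}}$, $0<n_1<\cdots<n_s$, and the $r_i\ge 1$ are (possibly infinite) cardinals. Let $\mathcal E$ be the endomorphism ring of $G$, $\mathcal J$ its Jacobson radical, and $\Delta(G)=1+\mathcal J\le \mathrm{Aut}(G)$. The upper annihilating sequence of $\mathcal J$ is defined by $\mathcal J_0=0$ and $\mathcal J_t=\{a\in\mathcal J: a\mathcal J\subseteq\mathcal J_{t-1},\ \mathcal Ja\subseteq\mathcal J_{t-1}\}$ for $t\ge1$, and its annihilating length $l(\mathcal J)$ is the number $d$ with $0=\mathcal J_0\subsetneq\mathcal J_1\subsetneq\cdots\subsetneq\mathcal J_d=\mathcal J$. Let $Z$ be the intersection of $\Delta(G)$ with the center of $\mathcal E$, let $(\mathcal Z_t)$ be the upper central series of $\Delta(G)$, and let $n(G)$ be the nilpotency class of $\Delta(G)$. The group $G$ is called a (uas)-(ucs)-group if $\mathcal Z_t=(\mathcal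 J_t+1)Z$ for all $1\le t\le n(G)$. For $1\le i,j\le s$ let $f_{\mathcal J}(i,j)=n_{\min(i,j)}$ if $i\neq j$ and $f_{\mathcal J}(i,i)=n_i-1$. Define $\alpha(s,s,1)=1$, $\alpha(i,j,1)=0$ for $(i,j)\ne(s,s)$, and for $t\ge2$ let $\alpha(i,j,t)$ be the minimum of $$n_j-n_{j-1}+\alpha(i,j-1,t-1),\quad n_i-n_{i-1}+\alpha(i-1,j,t-1),\quad \alpha(i,j,t-1)+1,\quad \alpha(i+1,j,t-1),\quad \alpha(i,j+1,t-1),$$ where terms with an index outside $\{1,\dots,s\}$ are omitted. Let $y(G)$ be the least $t\ge1$ such that $\alpha(i,j,t)\ge f_{\mathcal J}(i,j)$ for all $(i,j)\neq(s,s)$. If $G$ is a (uas)-(ucs)-group, then $\Delta(G)$ is nilpotent and the following hold. 1. If $r_s\ge2$, then $l(\mathcal J)$ exists and $n(G)=l(\mathcal J)$. 2. If $r_s=1$ and $G$ is not cyclic of order $p$, then $y(G)$ exists and $n(G)=y(G)$. -/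

import Mathlib

noncomputable section

namespace UasUcs

section Ideals

variable {R : Type*} [Ring R]

/-- For two-sided ideals `I` and `K`, the two-sided ideal of all `a ∈ I` with `a I ⊆ K` and
`I a ⊆ K`. -/
def annStep (I K : TwoSidedIdeal R) : TwoSidedIdeal R :=
  TwoSidedIdeal.mk' {a : R | a ∈ I ∧ ∀ b ∈ I, a * b ∈ K ∧ b * a ∈ K}
    ⟨I.zero_mem, fun b _ => by simp [K.zero_mem]⟩
    (fun {x y} hx hy => ⟨I.add_mem hx.1 hy.1, fun b hb => by
      rw [add_mul, mul_add]
      exact ⟨K.add_mem (hx.2 b hb).1 (hy.2 b hb).1, K.add_mem (hx.2 b hb).2 (hy.2 b hb).2⟩⟩)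
    (fun {x} hx => ⟨I.neg_mem hx.1, fun b hb => by
      rw [neg_mul, mul_neg]
      exact ⟨K.neg_mem (hx.2 b hb).1, K.neg_mem (hx.2 b hb).2⟩⟩)
    (fun {x y} hy => ⟨I.mul_mem_left x y hy.1, fun b hb => by
      rw [mul_assoc, ← mul_assoc b]
      exact ⟨K.mul_mem_left _ _ (hy.2 b hb).1, (hy.2 _ (I.mul_mem_right b x hb)).2⟩⟩)
    (fun {x y} hx => ⟨I.mul_mem_right x y hx.1, fun b hb => by
      rw [mul_assoc, ← mul_assoc b]
      exact ⟨(hx.2 _ (I.mul_mem_left y b hb)).1, K.mul_mem_right _ _ (hx.2 b hb).2⟩⟩)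

theorem mem_annStep {I K : TwoSidedIdeal R} {a : R} :
    a ∈ annStep I K ↔ a ∈ I ∧ ∀ b ∈ I, a * b ∈ K ∧ b * a ∈ K := by
  simp [annStep]

/-- The upper annihilating sequence of `I`: `I_0 = 0` and
`I_t = {a ∈ I : a I ⊆ I_{t-1}, I a ⊆ I_{t-1}}`. -/
def uas (I : TwoSidedIdeal R) : ℕ → TwoSidedIdeal R
  | 0 => ⊥
  | t + 1 => annStep I (uas I t)

/-- The annihilating length of `I` is `d`: `0 = I_0 ⊂ I_1 ⊂ ⋯ ⊂ I_d = I` with strict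
inclusions. -/
def HasAnnihilatingLength (I : TwoSidedIdeal R) (d : ℕ) : Prop :=
  (∀ t < d, uas I t < uas I (t + 1)) ∧ uas I d = I

/-- The subgroup `I + 1` of the group of units of `R`. -/
def onePlus (I : TwoSidedIdeal R) : Subgroup Rˣ where
  carrier := {u : Rˣ | (u : R) - 1 ∈ I}
  one_mem' := by simp [I.zero_mem]
  mul_mem' {u v} hu hv := by
    have h : ((u * v : Rˣ) : R) - 1 = ((u : R) - 1) * (v : R) + ((v : R) - 1) := by
      push_cast
      noncomm_ring
    rw [Set.mem_ofPred_eq, h]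
    exact I.add_mem (I.mul_mem_right _ _ hu) hv
  inv_mem' {u} hu := by
    have h : ((u⁻¹ : Rˣ) : R) - 1 = -(((u⁻¹ : Rˣ) : R) * ((u : R) - 1)) := by
      rw [mul_sub, Units.inv_mul]
      simp
    rw [Set.mem_ofPred_eq, h]
    exact I.neg_mem (I.mul_mem_left _ _ hu)

/-- The set `Γ_t = (I_t + 1) Z`, where `(I_t)` is the upper annihilating sequence of `I` and
`Z` is the intersection of `I + 1` with the center of `R`, as a subset of `I + 1`. -/
def gammaSet (I : TwoSidedIdeal R) (t : ℕ) : Set (onePlus I) :=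
  {g | ∃ x z : onePlus I, ((x : Rˣ) : R) - 1 ∈ uas I t ∧
    ((z : Rˣ) : R) ∈ Subring.center R ∧ g = x * z}

end Ideals

section Group

variable (G : Type*) [AddCommGroup G]

/-- The Jacobson radical of the endomorphism ring of `G`, as a two-sided ideal. -/
def radEnd : TwoSidedIdeal (AddMonoid.End G) :=
  (Ring.jacobson (AddMonoid.End G)).toTwoSided

/-- `Δ(G) = J + 1`, a subgroup of the automorphism group of `G` (the unit group of the
endomorphism ring). -/
abbrev Delta : Subgroup (AddMonoid.End G)ˣ := onePlus (radEnd G)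

/-- `G` is a (uas)-(ucs)-group: the `t`-th term of the upper central series of `Δ(G)` is
`Γ_t = (J_t + 1) Z` for all `t` from `1` to the nilpotency class of `Δ(G)`. -/
def IsUasUcsGroup : Prop :=
  ∀ t : ℕ, 1 ≤ t → t ≤ Group.nilpotencyClass (Delta G) →
    (Subgroup.upperCentralSeries (Delta G) t : Set (Delta G)) = gammaSet (radEnd G) t

end Group

section UpperFunction

variable {m : ℕ}

/-- The upper function of the type `(n_1, …, n_s)`, `s = m + 1`; here `upperFn n t i j` is
`α(i, j, t)`. It starts with `α(s, s, 1) = 1` and `α(i, j, 1) = 0` otherwise, and `α(i, j, t)` is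
the minimum of `α(i, j, t-1) + 1`, `n_j - n_{j-1} + α(i, j-1, t-1)`,
`n_i - n_{i-1} + α(i-1, j, t-1)`, `α(i+1, j, t-1)` and `α(i, j+1, t-1)`, where the terms with an
index outside `{1, …, s}` are omitted. -/
def upperFn (n : Fin (m + 1) → ℕ) : ℕ → Fin (m + 1) → Fin (m + 1) → ℕ
  | 0, _, _ => 0
  | 1, i, j => if i = Fin.last m ∧ j = Fin.last m then 1 else 0
  | t + 2, i, j => sInf {x : ℕ |
      x = upperFn n (t + 1) i j + 1 ∨
      (∃ k : Fin (m + 1), (k : ℕ) + 1 = j ∧ x = n j - n k + upperFn n (t + 1) i k) ∨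
      (∃ k : Fin (m + 1), (k : ℕ) + 1 = i ∧ x = n i - n k + upperFn n (t + 1) k j) ∨
      (∃ k : Fin (m + 1), (k : ℕ) = i + 1 ∧ x = upperFn n (t + 1) k j) ∨
      (∃ k : Fin (m + 1), (k : ℕ) = j + 1 ∧ x = upperFn n (t + 1) i k)}

/-- `f_J(i, j)`: it is `n_{min(i, j)}` for `i ≠ j` and `n_i - 1` for `i = j`. -/
def radFn (n : Fin (m + 1) → ℕ) (i j : Fin (m + 1)) : ℕ :=
  if i = j then n i - 1 else n (min i j)

/-- `y(G) = t`: `t` is the least `t ≥ 1` with `α(i, j, t) ≥ f_J(i, j)` for all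
`(i, j) ≠ (s, s)`. -/
def IsY (n : Fin (m + 1) → ℕ) (t : ℕ) : Prop :=
  IsLeast {t : ℕ | 1 ≤ t ∧ ∀ i j : Fin (m + 1), (i, j) ≠ (Fin.last m, Fin.last m) →
    radFn n i j ≤ upperFn n t i j} t

end UpperFunction

end UasUcs

end

/-!
The relations between the nilpotency class `d` of `Δ(G) = 1 + J`, the upper annihilating sequence
`(J_t)` of the Jacobson radical `J` of `End G` and the upper function `α` come from writing
endomorphisms of `G` as matrices over the cyclic summands of `G`, indexed by `x = (i, u)` with
`u : ι i`.

An entry from a summand of type `i` to one of type `j` is measured by the power of `p` that kills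
it, and `entries e β` is the group of endomorphisms whose entries of type `(i, j)` are killed by
`p ^ β i j`. One estimate for products of matrices (`mul_mem_entries`) gives all inclusions between
such groups. With it, `J = entries e f_J` (`mem_radEnd_iff`) and
`J_t = J ∩ entries e α(·, ·, t)` (`mem_uas_radEnd_iff`): the terms of the recursion for `α` are
what multiplication by `p` and by the maps between summands of neighbouring types requires.
The upper function grows without bound, so `J_t = J` for large `t`, and `1 + J_t ≤ Z_t` shows that
`Δ(G)` is nilpotent.

The center of `End G` consists of integer multiplications, hence the equation
`Δ(G) = (1 + J_d) Z` of a (uas)-(ucs)-group with `d ≥ 1` says that `J = J_d + pℤ`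
(`IsUasUcsGroup.exists_sub_mem_uas`). If `p ^ (d + 1)` kills `G`, then `J ^ (d + 1) = 0` and
`J_d = J` (`IsUasUcsGroup.uas_eq`).

* If `r_s ≥ 2`, an off-diagonal entry `p` between two summands of maximal order survives the
  subtraction of a scalar, so that it occurs in `J_d`. This forces `p ^ (d + 1) G = 0` and
  `J_d = J`. Since `1 + J_t ≤ Z_t`, no earlier `J_t` equals `J`
  (`IsUasUcsGroup.hasAnnihilatingLength`).
* If `r_s = 1`, the same comparison of entries gives `α(i, j, d) ≥ f_J(i, j)` for
  `(i, j) ≠ (s, s)` (`IsUasUcsGroup.radFn_le_upperFn`). Conversely, these inequalities at some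
  `t ≥ 1` say that `J_t` contains all of `J` except for the single entry at `(s, s)`, which a
  scalar corrects; then `Δ(G) = (1 + J_t) Z ≤ Z_t` (`nilpotencyClass_le_of_radFn_le`). The class
  vanishes only for cyclic `G` of order `p`.
-/

/-! ### The upper annihilating sequence and the upper central series -/

namespace UasUcs

section Ring

variable {R : Type*} [Ring R] {I : TwoSidedIdeal R}

theorem mem_uas_zero {a : R} : a ∈ uas I 0 ↔ a = 0 :=
  TwoSidedIdeal.mem_bot R

theorem mem_uas_succ {t : ℕ} {a : R} :
    a ∈ uas I (t + 1) ↔ a ∈ I ∧ ∀ b ∈ I, a * b ∈ uas I t ∧ b * a ∈ uas I t :=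
  mem_annStep

theorem uas_le (t : ℕ) : uas I t ≤ I := by
  intro a ha
  cases t with
  | zero => rw [mem_uas_zero.1 ha]; exact I.zero_mem
  | succ t => exact (mem_uas_succ.1 ha).1

theorem uas_le_succ (t : ℕ) : uas I t ≤ uas I (t + 1) := by
  induction t with
  | zero => intro a ha; rw [mem_uas_zero.1 ha]; exact TwoSidedIdeal.zero_mem _
  | succ t ih =>
    intro a ha
    rw [mem_uas_succ] at ha ⊢
    exact ⟨ha.1, fun b hb => ⟨ih (ha.2 b hb).1, ih (ha.2 b hb).2⟩⟩

theorem uas_add_of_eq_succ {t : ℕ} (h : uas I t = uas I (t + 1)) (k : ℕ) :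
    uas I (t + k) = uas I t := by
  induction k with
  | zero => rfl
  | succ k ih =>
    change annStep I (uas I (t + k)) = uas I t
    rw [ih]
    exact h.symm

/-- Multiplying `k` times by elements of `I` lowers the position in the sequence by `k`. -/
theorem pow_mul_mem_uas {c : R} (hc : c ∈ I) (k : ℕ) {t : ℕ} {a : R}
    (ha : a ∈ uas I (t + k)) : c ^ k * a ∈ uas I t := by
  induction k generalizing a with
  | zero => simpa using ha
  | succ k ih =>
    rw [pow_succ, mul_assoc]
    exact ih ((mem_uas_succ.1 ha).2 c hc).2

/-- The inclusion `1 + I_t ≤ Z_t`, which holds because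
`[1 + a, 1 + b] - 1 = (ab - ba)(1 + a)⁻¹(1 + b)⁻¹`. -/
theorem mem_upperCentralSeries_of_mem_uas (t : ℕ) (x : onePlus I)
    (hx : ((x : Rˣ) : R) - 1 ∈ uas I t) :
    x ∈ Subgroup.upperCentralSeries (onePlus I) t := by
  induction t generalizing x with
  | zero =>
    rw [mem_uas_zero, sub_eq_zero] at hx
    rw [Subgroup.upperCentralSeries_zero, Subgroup.mem_bot]
    ext
    simpa using hx
  | succ t ih =>
    rw [Subgroup.mem_upperCentralSeries_succ_iff]
    intro y
    apply ih
    have hy : ((y : Rˣ) : R) - 1 ∈ I := y.2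
    have hc := (mem_uas_succ.1 hx).2 _ hy
    have key : (((x * y * x⁻¹ * y⁻¹ : onePlus I) : Rˣ) : R) - 1 =
        ((((x : Rˣ) : R) - 1) * (((y : Rˣ) : R) - 1) -
          (((y : Rˣ) : R) - 1) * (((x : Rˣ) : R) - 1)) *
          (((x : Rˣ)⁻¹ : Rˣ) : R) * (((y : Rˣ)⁻¹ : Rˣ) : R) := by
      have h1 : (((x : Rˣ) : R) - 1) * (((y : Rˣ) : R) - 1) -
          (((y : Rˣ) : R) - 1) * (((x : Rˣ) : R) - 1) =
          ((x : Rˣ) : R) * ((y : Rˣ) : R) - ((y : Rˣ) : R) * ((x : Rˣ) : R) := by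
        noncomm_ring
      rw [h1, sub_mul, sub_mul]
      simp [mul_assoc]
    rw [commutatorElement_def, key]
    exact TwoSidedIdeal.mul_mem_right _ _ _ (TwoSidedIdeal.mul_mem_right _ _ _
      (TwoSidedIdeal.sub_mem _ hc.1 hc.2))

theorem mem_upperCentralSeries_of_mem_center {t : ℕ} (ht : 1 ≤ t) (z : onePlus I)
    (hz : ((z : Rˣ) : R) ∈ Subring.center R) :
    z ∈ Subgroup.upperCentralSeries (onePlus I) t := by
  apply Subgroup.upperCentralSeries_mono _ ht
  rw [Subgroup.upperCentralSeries_one, Subgroup.mem_center_iff]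
  intro g
  ext
  exact Subring.mem_center_iff.1 hz _

theorem gammaSet_subset_upperCentralSeries {t : ℕ} (ht : 1 ≤ t) :
    gammaSet I t ⊆ Subgroup.upperCentralSeries (onePlus I) t := by
  rintro g ⟨x, z, hx, hz, rfl⟩
  exact mul_mem (mem_upperCentralSeries_of_mem_uas t x hx)
    (mem_upperCentralSeries_of_mem_center ht z hz)

theorem upperCentralSeries_eq_top_of_uas_eq {t : ℕ} (h : uas I t = I) :
    Subgroup.upperCentralSeries (onePlus I) t = ⊤ :=
  eq_top_iff.2 fun x _ => mem_upperCentralSeries_of_mem_uas t x (h.symm ▸ x.2)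

theorem isNilpotent_of_uas_eq {t : ℕ} (h : uas I t = I) : Group.IsNilpotent (onePlus I) :=
  ⟨⟨t, upperCentralSeries_eq_top_of_uas_eq h⟩⟩

/-- If the upper annihilating sequence has reached `I` at the nilpotency class of `1 + I`, then
it cannot have stopped growing earlier, since `1 + I_t ≤ Z_t`. -/
theorem hasAnnihilatingLength_nilpotencyClass
    (h : uas I (Group.nilpotencyClass (onePlus I)) = I) :
    HasAnnihilatingLength I (Group.nilpotencyClass (onePlus I)) := by
  have hnil := isNilpotent_of_uas_eq h
  refine ⟨fun t ht => lt_of_le_of_ne (uas_le_succ t) fun heq => ?_, h⟩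
  obtain ⟨k, hk⟩ := Nat.exists_eq_add_of_lt ht
  have h1 : uas I t = I := by
    rw [← uas_add_of_eq_succ heq (k + 1), ← add_assoc, ← hk, h]
  have := Subgroup.upperCentralSeries_eq_top_iff_nilpotencyClass_le.1
    (upperCentralSeries_eq_top_of_uas_eq h1)
  omega

/-- If every element of `I` is an element of `I_d` plus a multiple of a central element `c ∈ I`
with `c ^ (d + 1) = 0`, then `I_d = I`: a product of `d + 1` elements of `I` vanishes, as it is a
multiple of `c ^ (d + 1)` up to products with a factor in `I_d`. The proof shows
`c ^ (d + 1 - t) ∈ I_t` by induction on `t ≤ d`. -/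
theorem uas_eq_of_central {c : R} (hcI : c ∈ I) (hc : c ∈ Subring.center R) {d : ℕ}
    (hc0 : c ^ (d + 1) = 0) (h : ∀ a ∈ I, ∃ k : ℕ, a - c * k ∈ uas I d) : uas I d = I := by
  have hcomm (x : R) : x * c = c * x := Subring.mem_center_iff.1 hc x
  have hcpow (j : ℕ) (x : R) : x * c ^ j = c ^ j * x := (Commute.pow_right (hcomm x) j)
  have hpowI (j : ℕ) (hj : 1 ≤ j) : c ^ j ∈ I := by
    obtain ⟨j, rfl⟩ := Nat.exists_eq_add_of_le' hj
    rw [pow_succ]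
    exact I.mul_mem_left _ _ hcI
  have key (t : ℕ) (ht : t ≤ d) : c ^ (d + 1 - t) ∈ uas I t := by
    induction t with
    | zero => exact mem_uas_zero.2 hc0
    | succ t ih =>
      have ht' := ih (by omega)
      rw [mem_uas_succ]
      refine ⟨hpowI _ (by omega), fun b hb => ?_⟩
      rw [hcpow, and_self]
      obtain ⟨k, hk⟩ := h b hb
      have h1 : c ^ (d + 1 - (t + 1)) * (b - c * k) ∈ uas I t :=
        pow_mul_mem_uas hcI _ (by convert hk using 2; omega)
      have h2 : c ^ (d + 1 - (t + 1)) * b =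
          c ^ (d + 1 - (t + 1)) * (b - c * k) + c ^ (d + 1 - t) * k := by
        rw [show d + 1 - t = (d + 1 - (t + 1)) + 1 by omega, pow_succ]
        noncomm_ring
      rw [h2]
      exact TwoSidedIdeal.add_mem _ h1 (TwoSidedIdeal.mul_mem_right _ _ _ ht')
  refine le_antisymm (uas_le d) fun a ha => ?_
  obtain ⟨k, hk⟩ := h a ha
  have hcd : c ∈ uas I d := by simpa using key d le_rfl
  have := TwoSidedIdeal.add_mem _ hk (TwoSidedIdeal.mul_mem_right _ c (k : R) hcd)
  simpa using this

theorem exists_onePlus_of_isNilpotent {a : R} (ha : a ∈ I) (hn : IsNilpotent a) :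
    ∃ g : onePlus I, ((g : Rˣ) : R) = 1 + a := by
  obtain ⟨u, hu⟩ := hn.isUnit_one_add
  exact ⟨⟨u, by change (u : R) - 1 ∈ I; rw [hu]; simpa using ha⟩, hu⟩

/-- If `1 + I = (1 + I_t) Z`, then every nilpotent element of `I` is congruent modulo `I_t` to a
central element of `I`. -/
theorem exists_central_of_mem_gammaSet {t : ℕ} (h : ∀ g : onePlus I, g ∈ gammaSet I t) {a : R}
    (ha : a ∈ I) (hn : IsNilpotent a) :
    ∃ c ∈ I, c ∈ Subring.center R ∧ a - c ∈ uas I t := by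
  obtain ⟨g, hg⟩ := exists_onePlus_of_isNilpotent ha hn
  obtain ⟨x, z, hx, hz, rfl⟩ := h g
  refine ⟨((z : Rˣ) : R) - 1, z.2, sub_mem hz (one_mem _), ?_⟩
  have : a - (((z : Rˣ) : R) - 1) = (((x : Rˣ) : R) - 1) * ((z : Rˣ) : R) := by
    have hg' : ((x : Rˣ) : R) * ((z : Rˣ) : R) = 1 + a := by simpa using hg
    rw [sub_mul, hg']
    noncomm_ring
  rw [this]
  exact TwoSidedIdeal.mul_mem_right _ _ _ hx

end Ring

/-! ### The upper function -/

section UpperFunction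

variable {m : ℕ} {n : Fin (m + 1) → ℕ}

/-- The recursion for `α(i, j, t)` as a characterization of its lower bounds. As `α(·, ·, 1)` is
what the recursion yields from `α(·, ·, 0) = 0`, it holds from `t = 0` on. -/
theorem le_upperFn_succ_iff (hn : StrictMono n) (t : ℕ) (i j : Fin (m + 1)) (b : ℕ) :
    b ≤ upperFn n (t + 1) i j ↔ b ≤ upperFn n t i j + 1 ∧
      (∀ k : Fin (m + 1), (k : ℕ) + 1 = j → b ≤ n j - n k + upperFn n t i k) ∧
      (∀ k : Fin (m + 1), (k : ℕ) + 1 = i → b ≤ n i - n k + upperFn n t k j) ∧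
      (∀ k : Fin (m + 1), (k : ℕ) = i + 1 → b ≤ upperFn n t k j) ∧
      (∀ k : Fin (m + 1), (k : ℕ) = j + 1 → b ≤ upperFn n t i k) := by
  cases t with
  | zero =>
    have h1 : upperFn n (0 + 1) i j = if i = Fin.last m ∧ j = Fin.last m then 1 else 0 := rfl
    have h0 (i j) : upperFn n 0 i j = 0 := rfl
    simp only [h1, h0]
    constructor
    · intro hb
      split_ifs at hb with h
      · obtain ⟨rfl, rfl⟩ := h
        refine ⟨by omega, fun k hk => ?_, fun k hk => ?_, fun k hk => ?_, fun k hk => ?_⟩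
        · have := hn (show k < Fin.last m from Fin.lt_def.2 (by omega))
          omega
        · have := hn (show k < Fin.last m from Fin.lt_def.2 (by omega))
          omega
        · have := k.2
          simp at hk
          omega
        · have := k.2
          simp at hk
          omega
      · simp [Nat.le_zero.1 hb]
    · rintro ⟨hb, -, -, hi, hj⟩
      split_ifs with h
      · omega
      · by_cases h' : i = Fin.last m
        · have hj' : j ≠ Fin.last m := fun hj' => h ⟨h', hj'⟩
          have := Fin.lt_def.1 (Fin.lt_last_iff_ne_last.2 hj')
          exact hj ⟨j + 1, by simpa using this⟩ rfl
        · have := Fin.lt_def.1 (Fin.lt_last_iff_ne_last.2 h')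
          exact hi ⟨i + 1, by simpa using this⟩ rfl
  | succ t =>
    rw [show upperFn n (t + 1 + 1) i j = sInf {x : ℕ | x = upperFn n (t + 1) i j + 1 ∨
      (∃ k : Fin (m + 1), (k : ℕ) + 1 = j ∧ x = n j - n k + upperFn n (t + 1) i k) ∨
      (∃ k : Fin (m + 1), (k : ℕ) + 1 = i ∧ x = n i - n k + upperFn n (t + 1) k j) ∨
      (∃ k : Fin (m + 1), (k : ℕ) = i + 1 ∧ x = upperFn n (t + 1) k j) ∨
      (∃ k : Fin (m + 1), (k : ℕ) = j + 1 ∧ x = upperFn n (t + 1) i k)} from rfl,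
      le_csInf_iff (OrderBot.bddBelow _) ⟨upperFn n (t + 1) i j + 1, Or.inl rfl⟩]
    constructor
    · intro h
      exact ⟨h _ (Or.inl rfl), fun k hk => h _ (Or.inr (Or.inl ⟨k, hk, rfl⟩)),
        fun k hk => h _ (Or.inr (Or.inr (Or.inl ⟨k, hk, rfl⟩))),
        fun k hk => h _ (Or.inr (Or.inr (Or.inr (Or.inl ⟨k, hk, rfl⟩)))),
        fun k hk => h _ (Or.inr (Or.inr (Or.inr (Or.inr ⟨k, hk, rfl⟩))))⟩
    · rintro ⟨h1, h2, h3, h4, h5⟩ x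
        (rfl | ⟨k, hk, rfl⟩ | ⟨k, hk, rfl⟩ | ⟨k, hk, rfl⟩ | ⟨k, hk, rfl⟩)
      exacts [h1, h2 k hk, h3 k hk, h4 k hk, h5 k hk]

theorem upperFn_comm (hn : StrictMono n) (t : ℕ) (i j : Fin (m + 1)) :
    upperFn n t i j = upperFn n t j i := by
  induction t generalizing i j with
  | zero => rfl
  | succ t ih =>
    refine eq_of_forall_le_iff fun b => ?_
    rw [le_upperFn_succ_iff hn, le_upperFn_succ_iff hn, ih i j]
    simp only [ih i, ih _ j]
    tauto

theorem upperFn_le_succ (hn : StrictMono n) (t : ℕ) (i j : Fin (m + 1)) :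
    upperFn n t i j ≤ upperFn n (t + 1) i j := by
  induction t generalizing i j with
  | zero => exact Nat.zero_le _
  | succ t ih =>
    obtain ⟨h1, h2, h3, h4, h5⟩ := (le_upperFn_succ_iff hn t i j _).1 le_rfl
    exact (le_upperFn_succ_iff hn _ _ _ _).2
      ⟨h1.trans (by gcongr; exact ih _ _), fun k hk => (h2 k hk).trans (by gcongr; exact ih _ _),
        fun k hk => (h3 k hk).trans (by gcongr; exact ih _ _), fun k hk => (h4 k hk).trans (ih _ _),
        fun k hk => (h5 k hk).trans (ih _ _)⟩

theorem upperFn_succ_le_add_one (hn : StrictMono n) (t : ℕ) (i j : Fin (m + 1)) :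
    upperFn n (t + 1) i j ≤ upperFn n t i j + 1 :=
  ((le_upperFn_succ_iff hn t i j _).1 le_rfl).1

/-- The recursive inequality `α(i, j, t+1) ≤ n_i - n_{i-1} + α(i-1, j, t)`, iterated. -/
theorem upperFn_succ_le_sub_add (hn : StrictMono n) (t : ℕ) {k i : Fin (m + 1)} (hk : k < i)
    (j : Fin (m + 1)) : upperFn n (t + 1) i j ≤ n i - n k + upperFn n t k j := by
  obtain ⟨d, hd⟩ := Nat.exists_eq_add_of_lt (Fin.lt_def.1 hk)
  induction d generalizing i with
  | zero => exact ((le_upperFn_succ_iff hn t i j _).1 le_rfl).2.2.1 k (by omega)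
  | succ d ih =>
    have hl : k.1 + d + 1 < m + 1 := by have := i.2; omega
    have hkl : k < ⟨k.1 + d + 1, hl⟩ := Fin.lt_def.2 (by change k.1 < k.1 + d + 1; omega)
    have h1 := ih hkl rfl
    have h2 := ((le_upperFn_succ_iff hn t i j _).1 le_rfl).2.2.1 ⟨k.1 + d + 1, hl⟩
      (by simp; omega)
    have h3 := upperFn_le_succ hn t ⟨k.1 + d + 1, hl⟩ j
    have h4 := hn hkl
    have h5 := hn (show (⟨k.1 + d + 1, hl⟩ : Fin (m + 1)) < i from Fin.lt_def.2 (by simp [hd]))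
    omega

/-- The recursive inequality `α(i, j, t+1) ≤ α(i+1, j, t)`, iterated. -/
theorem upperFn_succ_le_of_lt (hn : StrictMono n) (t : ℕ) {i k : Fin (m + 1)} (hk : i < k)
    (j : Fin (m + 1)) : upperFn n (t + 1) i j ≤ upperFn n t k j := by
  obtain ⟨d, hd⟩ := Nat.exists_eq_add_of_lt (Fin.lt_def.1 hk)
  induction d generalizing k with
  | zero => exact ((le_upperFn_succ_iff hn t i j _).1 le_rfl).2.2.2.1 k (by omega)
  | succ d ih =>
    have hl : i.1 + d + 1 < m + 1 := by have := k.2; omega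
    have h1 := ih (k := ⟨i.1 + d + 1, hl⟩)
      (Fin.lt_def.2 (by change i.1 < i.1 + d + 1; omega)) rfl
    have h2 := ((le_upperFn_succ_iff hn t ⟨i.1 + d + 1, hl⟩ j _).1 le_rfl).2.2.2.1 k
      (by change k.1 = i.1 + d + 1 + 1; omega)
    exact h1.trans ((upperFn_le_succ hn t _ j).trans h2)

/-- Linear growth of the upper function: each of the moves in its recursion raises the potential
`2 α(i, j) - i - j`. -/
theorem le_two_mul_upperFn_add (hn : StrictMono n) (t : ℕ) (i j : Fin (m + 1)) :
    t ≤ 2 * upperFn n t i j + (m - i) + (m - j) := by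
  induction t generalizing i j with
  | zero => exact Nat.zero_le _
  | succ t ih =>
    have hi := i.2
    have hj := j.2
    suffices (t + 2 - (m - i) - (m - j)) / 2 ≤ upperFn n (t + 1) i j by omega
    refine (le_upperFn_succ_iff hn t i j _).2 ⟨?_, fun k hk => ?_, fun k hk => ?_, fun k hk => ?_,
      fun k hk => ?_⟩
    · have := ih i j
      omega
    · have := ih i k
      have := hn (show k < j from Fin.lt_def.2 (by omega))
      omega
    · have := ih k j
      have := hn (show k < i from Fin.lt_def.2 (by omega))
      omega
    · have := ih k j
      have := k.2
      omega
    · have := ih i k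
      have := k.2
      omega

theorem radFn_eq (hn : StrictMono n) (i j : Fin (m + 1)) :
    radFn n i j = if i = j then n i - 1 else min (n i) (n j) := by
  rw [radFn, hn.monotone.map_min]

theorem radFn_le (hn : StrictMono n) (i j : Fin (m + 1)) : radFn n i j ≤ n (Fin.last m) := by
  have := hn.monotone (Fin.le_last i)
  rw [radFn_eq hn]
  split_ifs <;> omega

end UpperFunction

/-! ### Coordinates and matrix entries of endomorphisms -/

section Coordinates

variable {p : ℕ} {m : ℕ} {n : Fin (m + 1) → ℕ} {ι : Fin (m + 1) → Type*}
  {G : Type*} [AddCommGroup G] (e : G ≃+ (∀ i, ι i →₀ ZMod (p ^ n i)))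

open Classical in
/-- The generator of the cyclic summand with index `x`. The cyclic summands of `G` are indexed by
the pairs `x = (i, u)` with `u : ι i`, the one with index `x` having order `p ^ n x.1`. -/
noncomputable def gen (x : Σ i, ι i) : G :=
  e.symm (Pi.single x.1 (Finsupp.single x.2 1))

/-- The coordinate of an element of `G` in the cyclic summand with index `x`. -/
noncomputable def coord (x : Σ i, ι i) : G →+ ZMod (p ^ n x.1) :=
  (Finsupp.applyAddHom x.2).comp ((Pi.evalAddMonoidHom _ x.1).comp e.toAddMonoidHom)

theorem coord_apply (x : Σ i, ι i) (h : G) : coord e x h = e h x.1 x.2 := rfl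

@[simp]
theorem coord_gen_self (x : Σ i, ι i) : coord e x (gen e x) = 1 := by
  simp [coord_apply, gen]

theorem coord_gen_of_ne {x y : Σ i, ι i} (hxy : x ≠ y) : coord e y (gen e x) = 0 := by
  obtain ⟨i, u⟩ := x
  obtain ⟨j, v⟩ := y
  by_cases hij : i = j
  · subst hij
    have huv : u ≠ v := fun h => hxy (by rw [h])
    simp [coord_apply, gen, huv]
  · simp [coord_apply, gen, Pi.single_eq_of_ne (Ne.symm hij)]

theorem pow_smul_gen {x : Σ i, ι i} {k : ℕ} (hk : n x.1 ≤ k) : p ^ k • gen e x = 0 := by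
  have hz (z : ZMod (p ^ n x.1)) : p ^ k • z = 0 := by
    obtain ⟨d, rfl⟩ := Nat.exists_eq_add_of_le hk
    rw [pow_add, mul_comm, mul_smul, nsmul_eq_mul (p ^ n x.1), ZMod.natCast_self, zero_mul,
      smul_zero]
  rw [gen, ← map_nsmul]
  convert map_zero e.symm
  rw [← Pi.single_smul, Finsupp.smul_single, hz, Finsupp.single_zero, Pi.single_zero]

theorem smul_pow_smul_gen {y : Σ i, ι i} {N k : ℕ} (h : n y.1 ≤ N + k) :
    p ^ N • (p ^ k • gen e y) = 0 := by
  rw [← mul_smul, ← pow_add, pow_smul_gen e h]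

theorem eq_of_coord {g h : G} (H : ∀ x, coord e x g = coord e x h) : g = h := by
  apply e.injective
  funext i
  ext u
  exact H ⟨i, u⟩

theorem natCast_val_smul {N : ℕ} {c : G} (hc : N • c = 0) (k : ℕ) :
    ((k : ℕ) : ZMod N).val • c = k • c := by
  rw [ZMod.val_natCast]
  conv_rhs => rw [← Nat.mod_add_div k N, add_smul, mul_comm, mul_smul, hc, smul_zero, add_zero]

theorem one_val_smul {N : ℕ} {c : G} (hc : N • c = 0) : (1 : ZMod N).val • c = c := by
  have h := natCast_val_smul hc 1
  rwa [Nat.cast_one, one_smul] at h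

theorem lift_apply_eq_val {N : ℕ} [NeZero N] (f : {f : ℤ →+ G // f N = 0}) (z : ZMod N) :
    ZMod.lift N f z = f.1 z.val := by
  have h := ZMod.lift_coe N f (z.val : ℤ)
  rwa [Int.cast_natCast, ZMod.natCast_zmod_val] at h

theorem pow_smul_natCast_eq_zero_iff {N b k : ℕ} :
    p ^ b • (k : ZMod (p ^ N)) = 0 ↔ p ^ N ∣ p ^ b * k := by
  rw [nsmul_eq_mul, ← Nat.cast_mul, ZMod.natCast_eq_zero_iff]

/-- The endomorphisms whose matrix entries between cyclic summands of types `i` and `j` are killed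
by `p ^ β i j`. -/
def entries (β : Fin (m + 1) → Fin (m + 1) → ℕ) : AddSubgroup (AddMonoid.End G) where
  carrier := {a | ∀ x y : Σ i, ι i, p ^ β x.1 y.1 • coord e y (a (gen e x)) = 0}
  zero_mem' := by intro x y; simp
  add_mem' := by
    intro a b ha hb x y
    change p ^ β x.1 y.1 • coord e y (a (gen e x) + b (gen e x)) = 0
    rw [map_add, smul_add, ha x y, hb x y, add_zero]
  neg_mem' := by
    intro a ha x y
    change p ^ β x.1 y.1 • coord e y (-a (gen e x)) = 0
    rw [map_neg, smul_neg, ha x y, neg_zero]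

variable {e} in
theorem entries_mono {β γ : Fin (m + 1) → Fin (m + 1) → ℕ} (h : ∀ i j, β i j ≤ γ i j) :
    entries e β ≤ entries e γ := by
  intro a ha x y
  obtain ⟨d, hd⟩ := Nat.exists_eq_add_of_le (h x.1 y.1)
  rw [hd, pow_add, mul_comm, mul_smul, ha x y, smul_zero]

variable [hp : Fact p.Prime]

theorem eq_sum_gen (h : G) :
    h = ∑ i, ∑ u ∈ (e h i).support, (coord e ⟨i, u⟩ h).val • gen e ⟨i, u⟩ := by
  classical
  apply e.injective
  simp only [map_sum, map_nsmul, gen, AddEquiv.apply_symm_apply]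
  have h1 (i : Fin (m + 1)) : ∑ u ∈ (e h i).support, (coord e ⟨i, u⟩ h).val •
      (Pi.single i (Finsupp.single u 1) : ∀ i, ι i →₀ ZMod (p ^ n i)) = Pi.single i (e h i) := by
    conv_rhs => rw [← Finsupp.sum_single (e h i), Finsupp.sum]
    rw [← AddMonoidHom.single_apply, map_sum]
    refine Finset.sum_congr rfl fun u _ => ?_
    rw [AddMonoidHom.single_apply, ← Pi.single_smul, Finsupp.smul_single, nsmul_one,
      ZMod.natCast_zmod_val, coord_apply]
  rw [Finset.sum_congr rfl fun i _ => h1 i]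
  convert (Finset.univ_sum_single (e h)).symm

theorem end_ext {a b : AddMonoid.End G} (h : ∀ x, a (gen e x) = b (gen e x)) : a = b := by
  ext g
  rw [eq_sum_gen e g]
  simp only [map_sum, map_nsmul, h]

/-- An element of `ℤ / p ^ N` is killed by `p ^ b` iff it is divisible by `p ^ (N - b)`. -/
theorem pow_smul_eq_zero_iff {N b : ℕ} (z : ZMod (p ^ N)) :
    p ^ b • z = 0 ↔ p ^ (N - b) ∣ z.val := by
  have h : p ^ b • z = ((p ^ b * z.val : ℕ) : ZMod (p ^ N)) := by
    rw [Nat.cast_mul, ZMod.natCast_zmod_val, nsmul_eq_mul]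
  rw [h, ZMod.natCast_eq_zero_iff]
  clear h
  generalize z.val = v
  rcases le_total N b with hb | hb
  · simp [Nat.sub_eq_zero_of_le hb, (pow_dvd_pow p hb).mul_right]
  · have hd' : p ^ N = p ^ b * p ^ (N - b) := by rw [← pow_add]; congr 1; omega
    rw [hd']
    exact Nat.mul_dvd_mul_iff_left (pow_pos hp.out.pos _)

theorem pow_smul_pow_eq_zero_iff {N b c : ℕ} :
    p ^ b • ((p ^ c : ℕ) : ZMod (p ^ N)) = 0 ↔ N ≤ b + c := by
  rw [nsmul_eq_mul, ← Nat.cast_mul, ← pow_add, ZMod.natCast_eq_zero_iff,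
    Nat.pow_dvd_pow_iff_le_right hp.out.one_lt]

/-- The endomorphism that maps the generator with index `x` to `c` and the other generators
to `0`. -/
noncomputable def transfer (x : Σ i, ι i) (c : G) (hc : p ^ n x.1 • c = 0) : AddMonoid.End G :=
  (ZMod.lift (p ^ n x.1) ⟨(zmultiplesHom G) c, by
    rw [zmultiplesHom_apply, natCast_zsmul, hc]⟩).comp (coord e x)

theorem transfer_apply (x : Σ i, ι i) (c : G) (hc : p ^ n x.1 • c = 0) (g : G) :
    transfer e x c hc g = (coord e x g).val • c := by
  have h := lift_apply_eq_val (N := p ^ n x.1) ⟨(zmultiplesHom G) c, by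
    rw [zmultiplesHom_apply, natCast_zsmul, hc]⟩ (coord e x g)
  exact h.trans (natCast_zsmul _ _)

@[simp]
theorem transfer_gen_self (x : Σ i, ι i) (c : G) (hc : p ^ n x.1 • c = 0) :
    transfer e x c hc (gen e x) = c := by
  rw [transfer_apply, coord_gen_self, one_val_smul hc]

theorem transfer_gen_of_ne {x y : Σ i, ι i} (hxy : y ≠ x) (c : G) (hc : p ^ n x.1 • c = 0) :
    transfer e x c hc (gen e y) = 0 := by
  rw [transfer_apply, coord_gen_of_ne e hxy, ZMod.val_zero, zero_smul]

variable {e}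

/-- Matrix multiplication: an entry killed by `p ^ β` in `ℤ / p ^ N` is divisible by
`p ^ (N - β)`, and these divisibilities add up along the terms of a product of matrices. -/
theorem mul_mem_entries {β γ δ : Fin (m + 1) → Fin (m + 1) → ℕ} {a b : AddMonoid.End G}
    (ha : a ∈ entries e β) (hb : b ∈ entries e γ)
    (h : ∀ i k j, n j ≤ δ i j + (n k - β i k) + (n j - γ k j)) : b * a ∈ entries e δ := by
  intro x y
  change p ^ δ x.1 y.1 • coord e y (b (a (gen e x))) = 0
  rw [eq_sum_gen e (a (gen e x))]
  simp only [map_sum, map_nsmul, Finset.smul_sum]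
  refine Finset.sum_eq_zero fun k _ => Finset.sum_eq_zero fun u _ => ?_
  have h1 := (pow_smul_eq_zero_iff _).1 (ha x ⟨k, u⟩)
  have h2 := (pow_smul_eq_zero_iff _).1 (hb ⟨k, u⟩ y)
  obtain ⟨v, hv⟩ := h1
  obtain ⟨w, hw⟩ := h2
  rw [hv, ← ZMod.natCast_zmod_val (coord e y (b (gen e ⟨k, u⟩))), hw]
  simp only [nsmul_eq_mul]
  rw [← Nat.cast_mul, ← Nat.cast_mul, ZMod.natCast_eq_zero_iff]
  refine (pow_dvd_pow p (h x.1 k y.1)).trans ⟨v * w, ?_⟩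
  rw [pow_add, pow_add]
  ring

theorem mem_entries_of_min_le {β : Fin (m + 1) → Fin (m + 1) → ℕ}
    (h : ∀ i j, min (n i) (n j) ≤ β i j) (a : AddMonoid.End G) : a ∈ entries e β := by
  intro x y
  rcases min_le_iff.1 (h x.1 y.1) with h | h
  · rw [← map_nsmul, ← map_nsmul, pow_smul_gen e h, map_zero, map_zero]
  · rw [pow_smul_eq_zero_iff, Nat.sub_eq_zero_of_le h, pow_zero]
    exact one_dvd _

theorem eq_zero_of_mem_entries {β : Fin (m + 1) → Fin (m + 1) → ℕ} {a : AddMonoid.End G}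
    (ha : a ∈ entries e β) (h : ∀ i j, β i j = 0) : a = 0 := by
  refine end_ext e fun x => eq_of_coord e fun y => ?_
  have := ha x y
  rw [h, pow_zero, one_smul] at this
  simpa using this

theorem transfer_mem_entries {β : Fin (m + 1) → Fin (m + 1) → ℕ} {x y : Σ i, ι i} {k : ℕ}
    (hk : p ^ n x.1 • (p ^ k • gen e y) = 0) (h : n y.1 ≤ β x.1 y.1 + k) :
    transfer e x (p ^ k • gen e y) hk ∈ entries e β := by
  intro x' y'
  by_cases hx : x' = x
  · subst hx
    rw [transfer_gen_self, map_nsmul]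
    by_cases hy : y = y'
    · subst hy
      rw [coord_gen_self, nsmul_one, pow_smul_pow_eq_zero_iff]
      exact h
    · rw [coord_gen_of_ne e hy, smul_zero, smul_zero]
  · rw [transfer_gen_of_ne e hx, map_zero, smul_zero]

end Coordinates

/-! ### The Jacobson radical -/

section Radical

variable {p : ℕ} {m : ℕ} {n : Fin (m + 1) → ℕ} {ι : Fin (m + 1) → Type*}
  {G : Type*} [AddCommGroup G] {e : G ≃+ (∀ i, ι i →₀ ZMod (p ^ n i))}

theorem radFn_eq_of_exponents (hn : StrictMono n) (i j : Fin (m + 1)) :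
    radFn n i j = if n i = n j then n i - 1 else min (n i) (n j) := by
  rw [radFn, hn.monotone.map_min]
  simp only [hn.injective.eq_iff]

theorem exponent_pos (hn : StrictMono n) (hn0 : 0 < n 0) (i : Fin (m + 1)) : 0 < n i :=
  hn0.trans_le (hn.monotone (Fin.zero_le i))

theorem le_exponent_last (hn : StrictMono n) (i : Fin (m + 1)) : n i ≤ n (Fin.last m) :=
  hn.monotone (Fin.le_last i)

variable [hp : Fact p.Prime]

theorem mul_mem_entries_radFn (hn : StrictMono n) (hn0 : 0 < n 0) {a : AddMonoid.End G}
    (ha : a ∈ entries e (radFn n)) (b : AddMonoid.End G) : b * a ∈ entries e (radFn n) := by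
  refine mul_mem_entries ha (mem_entries_of_min_le (fun _ _ => le_rfl) b) fun i k j => ?_
  have := exponent_pos hn hn0 i
  have := exponent_pos hn hn0 j
  have := exponent_pos hn hn0 k
  simp only [radFn_eq_of_exponents hn]
  split_ifs <;> omega

/-- The entries of `a ^ t` become ever more divisible: with `d(j)` the exponent of the power of `p`
that is known to divide the entries into summands of type `j`, a further factor `a` raises
`2 d(j) - n j`. -/
theorem pow_mem_entries (hn : StrictMono n) (hn0 : 0 < n 0) {a : AddMonoid.End G}
    (ha : a ∈ entries e (radFn n)) (t : ℕ) :
    a ^ t ∈ entries e (fun _ j => n j - (t + n j - n (Fin.last m)) / 2) := by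
  induction t with
  | zero =>
    refine mem_entries_of_min_le (fun i j => ?_) _
    have := le_exponent_last hn j
    omega
  | succ t ih =>
    rw [pow_succ']
    refine mul_mem_entries ih ha fun i k j => ?_
    have := exponent_pos hn hn0 j
    have := exponent_pos hn hn0 k
    have := le_exponent_last hn j
    have := le_exponent_last hn k
    simp only [radFn_eq_of_exponents hn]
    split_ifs <;> omega

theorem isNilpotent_of_mem_entries_radFn (hn : StrictMono n) (hn0 : 0 < n 0)
    {a : AddMonoid.End G} (ha : a ∈ entries e (radFn n)) : IsNilpotent a := by
  refine ⟨2 * n (Fin.last m), eq_zero_of_mem_entries (pow_mem_entries hn hn0 ha _) fun i j => ?_⟩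
  have := le_exponent_last hn j
  omega

theorem mem_radEnd_iff_exists {a : AddMonoid.End G} :
    a ∈ radEnd G ↔ ∀ b, ∃ z, z * b * a + z - 1 = 0 := by
  rw [radEnd, Ideal.mem_toTwoSided, ← Ideal.jacobson_bot, Ideal.mem_jacobson_iff]
  simp only [Ideal.mem_bot]

theorem gen_ne_zero (hn : StrictMono n) (hn0 : 0 < n 0) (x : Σ i, ι i) : gen e x ≠ 0 := by
  intro h
  have : Fact (1 < p ^ n x.1) :=
    ⟨Nat.one_lt_pow (exponent_pos hn hn0 x.1).ne' hp.out.one_lt⟩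
  have h1 := coord_gen_self e x
  rw [h, map_zero] at h1
  exact zero_ne_one h1

/-- The Jacobson radical of `End G` consists of the endomorphisms all of whose entries between
summands of the same type are divisible by `p`. An element of the radical with a unit as such an
entry would have a multiple `a` fixing a generator, so that `1 - a` would not be injective. -/
theorem mem_radEnd_iff (hn : StrictMono n) (hn0 : 0 < n 0) {a : AddMonoid.End G} :
    a ∈ radEnd G ↔ a ∈ entries e (radFn n) := by
  constructor
  · rintro ha ⟨i, u⟩ ⟨j, v⟩
    by_cases hij : i = j
    · subst hij
      set w := coord e ⟨i, v⟩ (a (gen e ⟨i, u⟩)) with hw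
      have hpos := exponent_pos hn hn0 i
      rw [radFn, if_pos rfl, pow_smul_eq_zero_iff, show n i - (n i - 1) = 1 by omega, pow_one]
      by_contra hdvd
      have hunit : IsUnit w := by
        rw [← ZMod.natCast_zmod_val w, ZMod.isUnit_iff_coprime]
        exact ((hp.out.coprime_iff_not_dvd.2 hdvd).symm).pow_right _
      obtain ⟨s, hs⟩ := hunit.exists_right_inv
      have hord : p ^ n i • gen e ⟨i, u⟩ = 0 := pow_smul_gen e le_rfl
      have hc : p ^ n i • (s.val • gen e ⟨i, u⟩) = 0 := by
        rw [smul_comm, hord, smul_zero]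
      obtain ⟨z, hz⟩ := mem_radEnd_iff_exists.1 ha (-transfer e ⟨i, v⟩ _ hc)
      have hfix : transfer e ⟨i, v⟩ _ hc (a (gen e ⟨i, u⟩)) = gen e ⟨i, u⟩ := by
        rw [transfer_apply, ← mul_smul, ← natCast_val_smul hord, Nat.cast_mul]
        rw [← hw, ZMod.natCast_zmod_val, ZMod.natCast_zmod_val, hs,
          one_val_smul hord]
      apply gen_ne_zero (e := e) hn hn0 ⟨i, u⟩
      have h1 : z (-(transfer e ⟨i, v⟩ _ hc (a (gen e ⟨i, u⟩)))) + z (gen e ⟨i, u⟩) -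
          gen e ⟨i, u⟩ = 0 := DFunLike.congr_fun hz (gen e ⟨i, u⟩)
      rw [hfix, map_neg, neg_add_cancel, zero_sub, neg_eq_zero] at h1
      exact h1
    · rw [radFn, if_neg hij]
      exact mem_entries_of_min_le (e := e) (β := fun i j => n (min i j))
        (fun i j => (hn.monotone.map_min).ge) a ⟨i, u⟩ ⟨j, v⟩
  · intro ha
    rw [mem_radEnd_iff_exists]
    intro b
    obtain ⟨z, hz⟩ := (isNilpotent_of_mem_entries_radFn hn hn0
      (mul_mem_entries_radFn hn hn0 ha b)).isUnit_one_add
    refine ⟨((z⁻¹ : (AddMonoid.End G)ˣ) : AddMonoid.End G), ?_⟩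
    rw [mul_assoc, add_comm, ← mul_one_add, ← hz, Units.inv_mul, sub_self]

theorem transfer_mem_radEnd (hn : StrictMono n) (hn0 : 0 < n 0) {x y : Σ i, ι i} {k : ℕ}
    (hk : p ^ n x.1 • (p ^ k • gen e y) = 0) (h : n y.1 ≤ radFn n x.1 y.1 + k) :
    transfer e x (p ^ k • gen e y) hk ∈ radEnd G :=
  (mem_radEnd_iff hn hn0).2 (transfer_mem_entries hk h)

theorem natCast_prime_mem_radEnd (hn : StrictMono n) (hn0 : 0 < n 0)
    (e : G ≃+ (∀ i, ι i →₀ ZMod (p ^ n i))) : (p : AddMonoid.End G) ∈ radEnd G := by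
  rw [mem_radEnd_iff (e := e) hn hn0]
  intro x y
  rw [AddMonoid.End.natCast_apply, map_nsmul, ← mul_smul, ← pow_succ]
  refine mem_entries_of_min_le (e := e) (β := fun i j => radFn n i j + 1) (fun i j => ?_) 1 x y
  rw [radFn_eq_of_exponents hn]
  split_ifs <;> omega

theorem prime_dvd_coord_of_mem_radEnd (hn : StrictMono n) (hn0 : 0 < n 0) {a : AddMonoid.End G}
    (ha : a ∈ radEnd G) (y : Σ i, ι i) : p ∣ (coord e y (a (gen e y))).val := by
  have h := (mem_radEnd_iff (e := e) hn hn0).1 ha y y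
  have := exponent_pos hn hn0 y.1
  rwa [pow_smul_eq_zero_iff, radFn, if_pos rfl, show n y.1 - (n y.1 - 1) = 1 by omega,
    pow_one] at h

/-- Central elements of `End G` are multiplications by integers, as they commute with the maps
from a cyclic summand of maximal order onto the other cyclic summands; those in the radical are
multiplications by multiples of `p`. -/
theorem exists_eq_prime_mul_of_mem_center (hn : StrictMono n) (hn0 : 0 < n 0)
    (hι : ∀ i, Nonempty (ι i)) (e : G ≃+ (∀ i, ι i →₀ ZMod (p ^ n i))) {c : AddMonoid.End G}
    (hcJ : c ∈ radEnd G) (hc : c ∈ Subring.center (AddMonoid.End G)) :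
    ∃ k : ℕ, c = (p : AddMonoid.End G) * k := by
  obtain ⟨u⟩ := hι (Fin.last m)
  obtain ⟨k, hk⟩ := prime_dvd_coord_of_mem_radEnd (e := e) hn hn0 hcJ ⟨Fin.last m, u⟩
  refine ⟨k, end_ext e fun x => ?_⟩
  have hx : p ^ n (Fin.last m) • gen e x = 0 := pow_smul_gen e (le_exponent_last hn x.1)
  have hT : transfer e ⟨Fin.last m, u⟩ (gen e x) hx (gen e ⟨Fin.last m, u⟩) = gen e x :=
    transfer_gen_self e ⟨Fin.last m, u⟩ (gen e x) hx
  have h1 : transfer e ⟨Fin.last m, u⟩ (gen e x) hx (c (gen e ⟨Fin.last m, u⟩)) =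
      c (transfer e ⟨Fin.last m, u⟩ (gen e x) hx (gen e ⟨Fin.last m, u⟩)) :=
    DFunLike.congr_fun (Subring.mem_center_iff.1 hc
      (transfer e ⟨Fin.last m, u⟩ (gen e x) hx)) (gen e ⟨Fin.last m, u⟩)
  rw [hT, transfer_apply, hk, mul_smul] at h1
  exact h1.symm

/-! ### The upper annihilating sequence of the radical -/

/-- The upper annihilating sequence of the Jacobson radical is described by the upper function:
one inclusion is matrix multiplication, the other tests an element against multiplication by `p`
and against the maps between cyclic summands of neighbouring types. -/
theorem mem_uas_radEnd_iff (hn : StrictMono n) (hn0 : 0 < n 0) (hι : ∀ i, Nonempty (ι i))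
    (t : ℕ) {a : AddMonoid.End G} :
    a ∈ uas (radEnd G) t ↔ a ∈ radEnd G ∧ a ∈ entries e (upperFn n t) := by
  induction t generalizing a with
  | zero =>
    rw [mem_uas_zero]
    constructor
    · rintro rfl
      exact ⟨TwoSidedIdeal.zero_mem _, zero_mem _⟩
    · intro h
      exact eq_zero_of_mem_entries h.2 fun _ _ => rfl
  | succ t ih =>
    rw [mem_uas_succ]
    simp only [ih]
    refine and_congr_right fun ha => ⟨?_, ?_⟩
    · rintro h ⟨i, u⟩ ⟨j, v⟩
      set w := coord e ⟨j, v⟩ (a (gen e ⟨i, u⟩)) with hw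
      have hex : ∃ c, p ^ c • w = 0 := ⟨n j, by simp⟩
      suffices hle : Nat.find hex ≤ upperFn n (t + 1) i j by
        obtain ⟨d, hd⟩ := Nat.exists_eq_add_of_le hle
        dsimp only
        rw [hd, pow_add, mul_comm, mul_smul, Nat.find_spec hex, smul_zero]
      -- The product of `a` with `b` on the left, seen in the coordinate `z`.
      have hleft (z : Σ i, ι i) (c : ℕ) (hc : n z.1 ≤ n j + c) (hc' : n z.1 ≤ radFn n j z.1 + c) :
          p ^ n z.1 ∣ p ^ (upperFn n t i z.1 + c) * w.val := by
        have hk : p ^ n j • (p ^ c • gen e z) = 0 := smul_pow_smul_gen e hc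
        have h1 : p ^ upperFn n t i z.1 • coord e z
            (transfer e ⟨j, v⟩ (p ^ c • gen e z) hk (a (gen e ⟨i, u⟩))) = 0 :=
          (h _ (transfer_mem_radEnd hn hn0 hk hc')).2.2 ⟨i, u⟩ z
        rw [transfer_apply, ← hw, map_nsmul, map_nsmul, coord_gen_self, smul_comm w.val,
          ← mul_smul, ← pow_add, nsmul_one, pow_smul_natCast_eq_zero_iff] at h1
        exact h1
      -- The product of `a` with `b` on the right, evaluated at the generator `z`.
      have hright (z : Σ i, ι i) (c : ℕ) (hc : n i ≤ n z.1 + c) (hc' : n i ≤ radFn n z.1 i + c) :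
          p ^ (upperFn n t z.1 j + c) • w = 0 := by
        have hk : p ^ n z.1 • (p ^ c • gen e ⟨i, u⟩) = 0 := smul_pow_smul_gen e hc
        have h1 : p ^ upperFn n t z.1 j • coord e ⟨j, v⟩
            (a (transfer e z (p ^ c • gen e ⟨i, u⟩) hk (gen e z))) = 0 :=
          (h _ (transfer_mem_radEnd hn hn0 hk hc')).1.2 z ⟨j, v⟩
        rw [transfer_gen_self, map_nsmul, map_nsmul, ← mul_smul, ← pow_add] at h1
        exact h1
      refine (le_upperFn_succ_iff hn _ _ _ _).2 ⟨Nat.find_min' hex ?_, fun k hk =>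
        Nat.find_min' hex ?_, fun k hk => Nat.find_min' hex ?_, fun k hk => Nat.find_min' hex ?_,
        fun k hk => Nat.find_min' hex ?_⟩
      · have h1 : p ^ upperFn n t i j • coord e ⟨j, v⟩ (p • a (gen e ⟨i, u⟩)) = 0 :=
          (h _ (natCast_prime_mem_radEnd hn hn0 e)).2.2 ⟨i, u⟩ ⟨j, v⟩
        rw [map_nsmul, ← mul_smul, ← pow_succ] at h1
        exact h1
      · have hlt := hn (show k < j from Fin.lt_def.2 (by omega))
        obtain ⟨z⟩ := hι k
        have h1 := hleft ⟨k, z⟩ 0 (by dsimp only; omega) (by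
          simp only [radFn_eq_of_exponents hn]
          split_ifs <;> omega)
        rw [pow_smul_eq_zero_iff]
        rw [add_zero, ← pow_smul_natCast_eq_zero_iff] at h1
        have := Nat.mul_dvd_mul_left (p ^ (n j - n k)) (pow_smul_natCast_eq_zero_iff.1 h1)
        rw [← mul_assoc, ← pow_add, ← pow_add, Nat.sub_add_cancel hlt.le,
          ← pow_smul_natCast_eq_zero_iff, ZMod.natCast_zmod_val, pow_smul_eq_zero_iff] at this
        exact this
      · have hlt := hn (show k < i from Fin.lt_def.2 (by omega))
        obtain ⟨z⟩ := hι k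
        rw [add_comm (n i - n k)]
        refine hright ⟨k, z⟩ _ (by dsimp only; omega) ?_
        simp only [radFn_eq_of_exponents hn]
        split_ifs <;> omega
      · have hlt := hn (show i < k from Fin.lt_def.2 (by omega))
        obtain ⟨z⟩ := hι k
        refine hright ⟨k, z⟩ 0 (by dsimp only; omega) ?_
        simp only [radFn_eq_of_exponents hn]
        split_ifs <;> omega
      · have hlt := hn (show j < k from Fin.lt_def.2 (by omega))
        obtain ⟨z⟩ := hι k
        have h1 := hleft ⟨k, z⟩ (n k - n j) (by dsimp only; omega) (by
          simp only [radFn_eq_of_exponents hn]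
          split_ifs <;> omega)
        dsimp only at h1
        rw [add_comm (upperFn n t i k), pow_add, mul_assoc] at h1
        conv_lhs at h1 => rw [← Nat.sub_add_cancel hlt.le, pow_add]
        have h2 := (Nat.mul_dvd_mul_iff_left (pow_pos hp.out.pos _)).1 h1
        rw [← pow_smul_natCast_eq_zero_iff, ZMod.natCast_zmod_val] at h2
        exact h2
    · intro h b hb
      have hR := (mem_radEnd_iff (e := e) hn hn0).1 hb
      have hmul (c d : AddMonoid.End G) (hd : d ∈ radEnd G) : c * d ∈ radEnd G :=
        TwoSidedIdeal.mul_mem_left _ _ _ hd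
      refine ⟨⟨hmul _ _ hb, mul_mem_entries hR h fun i k j => ?_⟩,
        ⟨hmul _ _ ha, mul_mem_entries h hR fun i k j => ?_⟩⟩
      · have := exponent_pos hn hn0 i
        have := exponent_pos hn hn0 k
        rw [radFn_eq_of_exponents hn]
        rcases lt_trichotomy i k with hik | rfl | hik
        · have := hn hik
          have := upperFn_succ_le_sub_add hn t hik j
          split_ifs <;> omega
        · have := upperFn_succ_le_add_one hn t i j
          split_ifs <;> omega
        · have := hn hik
          have := upperFn_succ_le_of_lt hn t hik j
          split_ifs <;> omega
      · have := exponent_pos hn hn0 j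
        have := exponent_pos hn hn0 k
        rw [radFn_eq_of_exponents hn, upperFn_comm hn (t + 1) i k, upperFn_comm hn t i j]
        rcases lt_trichotomy j k with hik | rfl | hik
        · have := hn hik
          have := upperFn_succ_le_sub_add hn t hik i
          split_ifs <;> omega
        · have := upperFn_succ_le_add_one hn t j i
          split_ifs <;> omega
        · have := hn hik
          have := upperFn_succ_le_of_lt hn t hik i
          split_ifs <;> omega

/-- The upper annihilating sequence exhausts the radical, as the upper function is unbounded. -/
theorem exists_uas_radEnd_eq (hn : StrictMono n) (hn0 : 0 < n 0) (hι : ∀ i, Nonempty (ι i))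
    (e : G ≃+ (∀ i, ι i →₀ ZMod (p ^ n i))) : ∃ t, uas (radEnd G) t = radEnd G := by
  refine ⟨2 * n (Fin.last m) + 2 * m, le_antisymm (uas_le _) fun a ha => ?_⟩
  refine (mem_uas_radEnd_iff (e := e) hn hn0 hι _).2
    ⟨ha, entries_mono (fun i j => ?_) ((mem_radEnd_iff hn hn0).1 ha)⟩
  have h1 := radFn_le hn i j
  have h2 := le_two_mul_upperFn_add hn (2 * n (Fin.last m) + 2 * m) i j
  omega

end Radical

/-! ### Consequences of the (uas)-(ucs) property -/

section Group

variable {p : ℕ} {m : ℕ} {n : Fin (m + 1) → ℕ} {ι : Fin (m + 1) → Type*}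
  {G : Type*} [AddCommGroup G] {e : G ≃+ (∀ i, ι i →₀ ZMod (p ^ n i))}

theorem coord_sub_natCast_mul (a : AddMonoid.End G) (k : ℕ) (x y : Σ i, ι i) :
    coord e y ((a - (p : AddMonoid.End G) * k) (gen e x)) =
      coord e y (a (gen e x)) - p • k • coord e y (gen e x) := by
  change coord e y (a (gen e x) - p • k • gen e x) = _
  rw [map_sub, map_nsmul, map_nsmul]

variable [hp : Fact p.Prime]

theorem isNilpotent_Delta (hn : StrictMono n) (hn0 : 0 < n 0) (hι : ∀ i, Nonempty (ι i))
    (e : G ≃+ (∀ i, ι i →₀ ZMod (p ^ n i))) : Group.IsNilpotent (Delta G) :=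
  (exists_uas_radEnd_eq hn hn0 hι e).elim fun _ h => isNilpotent_of_uas_eq h

theorem radEnd_eq_bot_of_nilpotencyClass_eq_zero (hn : StrictMono n) (hn0 : 0 < n 0)
    (hι : ∀ i, Nonempty (ι i)) (e : G ≃+ (∀ i, ι i →₀ ZMod (p ^ n i)))
    (h : Group.nilpotencyClass (Delta G) = 0) {a : AddMonoid.End G} (ha : a ∈ radEnd G) :
    a = 0 := by
  have := isNilpotent_Delta hn hn0 hι e
  have := Group.nilpotencyClass_zero_iff_subsingleton.1 h
  obtain ⟨g, hg⟩ := exists_onePlus_of_isNilpotent ha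
    (isNilpotent_of_mem_entries_radFn hn hn0 ((mem_radEnd_iff (e := e) hn hn0).1 ha))
  rw [Subsingleton.elim g 1] at hg
  simpa using hg

/-- If `G` is a (uas)-(ucs)-group and `d ≥ 1` is the class of `Δ(G)`, then modulo `J_d` every
element of the radical is multiplication by a multiple of `p`. -/
theorem IsUasUcsGroup.exists_sub_mem_uas (hG : IsUasUcsGroup G) (hn : StrictMono n)
    (hn0 : 0 < n 0) (hι : ∀ i, Nonempty (ι i)) (e : G ≃+ (∀ i, ι i →₀ ZMod (p ^ n i)))
    (hd : 1 ≤ Group.nilpotencyClass (Delta G)) {a : AddMonoid.End G} (ha : a ∈ radEnd G) :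
    ∃ k : ℕ, a - (p : AddMonoid.End G) * k ∈
      uas (radEnd G) (Group.nilpotencyClass (Delta G)) := by
  have := isNilpotent_Delta hn hn0 hι e
  have h (g : Delta G) : g ∈ gammaSet (radEnd G) (Group.nilpotencyClass (Delta G)) := by
    rw [← hG _ hd le_rfl, Subgroup.upperCentralSeries_nilpotencyClass]
    exact Subgroup.mem_top g
  obtain ⟨c, hcJ, hc, hac⟩ := exists_central_of_mem_gammaSet h ha
    (isNilpotent_of_mem_entries_radFn hn hn0 ((mem_radEnd_iff (e := e) hn hn0).1 ha))
  obtain ⟨k, rfl⟩ := exists_eq_prime_mul_of_mem_center hn hn0 hι e hcJ hc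
  exact ⟨k, hac⟩

theorem upperFn_le (hn : StrictMono n) (t : ℕ) (i j : Fin (m + 1)) : upperFn n t i j ≤ t := by
  induction t with
  | zero => exact le_rfl
  | succ t ih => exact (upperFn_succ_le_add_one hn t i j).trans (by omega)

theorem IsUasUcsGroup.uas_eq (hG : IsUasUcsGroup G) (hn : StrictMono n)
    (hn0 : 0 < n 0) (hι : ∀ i, Nonempty (ι i)) (e : G ≃+ (∀ i, ι i →₀ ZMod (p ^ n i)))
    (hd : 1 ≤ Group.nilpotencyClass (Delta G))
    (h : n (Fin.last m) ≤ Group.nilpotencyClass (Delta G) + 1) :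
    uas (radEnd G) (Group.nilpotencyClass (Delta G)) = radEnd G := by
  refine uas_eq_of_central (natCast_prime_mem_radEnd hn hn0 e) (natCast_mem _ _) ?_
    fun a ha => hG.exists_sub_mem_uas hn hn0 hι e hd ha
  refine end_ext e fun x => ?_
  rw [← Nat.cast_pow, AddMonoid.End.natCast_apply,
    pow_smul_gen e ((le_exponent_last hn x.1).trans h)]
  rfl

/-- If the summands of maximal order have rank at least two, the annihilating length of the
radical is the class of `Δ(G)`. As an off-diagonal entry is not changed by subtracting a scalar,
`J_d`, where `d` is the class, contains an endomorphism with entry `p` between two cyclic summands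
of maximal order. This gives `p ^ (d + 1) G = 0`, hence `J_d = J`. -/
theorem IsUasUcsGroup.hasAnnihilatingLength (hG : IsUasUcsGroup G) (hn : StrictMono n)
    (hn0 : 0 < n 0) (hι : ∀ i, Nonempty (ι i)) (e : G ≃+ (∀ i, ι i →₀ ZMod (p ^ n i)))
    {u v : ι (Fin.last m)} (huv : u ≠ v) :
    HasAnnihilatingLength (radEnd G) (Group.nilpotencyClass (Delta G)) := by
  apply hasAnnihilatingLength_nilpotencyClass
  change uas (radEnd G) (Group.nilpotencyClass (Delta G)) = radEnd G
  rcases Nat.eq_zero_or_pos (Group.nilpotencyClass (Delta G)) with h0 | hd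
  · refine le_antisymm (uas_le _) fun a ha => ?_
    rw [radEnd_eq_bot_of_nilpotencyClass_eq_zero hn hn0 hι e h0 ha]
    exact TwoSidedIdeal.zero_mem _
  have hpos := exponent_pos hn hn0 (Fin.last m)
  apply hG.uas_eq hn hn0 hι e hd
  have hk : p ^ n (Fin.last m) • (p ^ 1 • gen e ⟨Fin.last m, v⟩) = 0 :=
    smul_pow_smul_gen e (Nat.le_add_right _ _)
  obtain ⟨k, hmem⟩ := hG.exists_sub_mem_uas hn hn0 hι e hd
    (transfer_mem_radEnd (x := ⟨Fin.last m, u⟩) hn hn0 hk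
      (by rw [radFn, if_pos rfl]; dsimp only; omega))
  have h1 := ((mem_uas_radEnd_iff (e := e) hn hn0 hι _).1 hmem).2 ⟨_, u⟩ ⟨_, v⟩
  rw [coord_sub_natCast_mul, transfer_gen_self, map_nsmul, coord_gen_self,
    coord_gen_of_ne e (by simpa using huv), smul_zero, smul_zero, sub_zero, nsmul_one,
    pow_smul_pow_eq_zero_iff] at h1
  exact h1.trans (Nat.add_le_add_right (upperFn_le hn _ _ _) 1)

/-- The class `d` of `Δ(G)` satisfies the inequalities that define `y(G)`. The radical being
`J_d + pℤ`, an endomorphism whose only entry is off the diagonal has an entry of maximal order in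
`J_d`. For the diagonal entries, the multiple of `p` that corresponds to `p` times the projection
to a summand of maximal order cannot agree with it on both diagonal blocks. -/
theorem IsUasUcsGroup.radFn_le_upperFn (hG : IsUasUcsGroup G) (hn : StrictMono n)
    (hn0 : 0 < n 0) (hι : ∀ i, Nonempty (ι i)) (e : G ≃+ (∀ i, ι i →₀ ZMod (p ^ n i)))
    (hd : 1 ≤ Group.nilpotencyClass (Delta G)) {i j : Fin (m + 1)}
    (hij : (i, j) ≠ (Fin.last m, Fin.last m)) :
    radFn n i j ≤ upperFn n (Group.nilpotencyClass (Delta G)) i j := by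
  obtain ⟨u⟩ := hι i
  obtain ⟨v⟩ := hι j
  by_cases h : i = j
  · subst h
    have hne : i ≠ Fin.last m := by simpa using hij
    rw [radFn, if_pos rfl]
    obtain ⟨w⟩ := hι (Fin.last m)
    have hpos := exponent_pos hn hn0 (Fin.last m)
    have hk : p ^ n (Fin.last m) • (p ^ 1 • gen e ⟨Fin.last m, w⟩) = 0 :=
      smul_pow_smul_gen e (Nat.le_add_right _ _)
    obtain ⟨k, hmem⟩ := hG.exists_sub_mem_uas hn hn0 hι e hd
      (transfer_mem_radEnd (x := ⟨Fin.last m, w⟩) hn hn0 hk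
        (by rw [radFn, if_pos rfl]; dsimp only; omega))
    have hent := ((mem_uas_radEnd_iff (e := e) hn hn0 hι _).1 hmem).2
    have hneq : (⟨i, u⟩ : Σ i, ι i) ≠ ⟨Fin.last m, w⟩ := fun h => hne (congrArg Sigma.fst h)
    by_cases hpk : p ∣ k
    · -- The entry at the summand of maximal order is `p` times a unit, which gives `J_d = J`.
      have h1 := hent ⟨_, w⟩ ⟨_, w⟩
      obtain ⟨k, rfl⟩ := hpk
      rw [coord_sub_natCast_mul, transfer_gen_self, map_nsmul, coord_gen_self] at h1
      have hnil : IsNilpotent ((p : ZMod (p ^ n (Fin.last m))) * k) :=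
        (Commute.all _ _).isNilpotent_mul_right
          ⟨n (Fin.last m), by rw [← Nat.cast_pow, ZMod.natCast_self]⟩
      have h2 : p ^ (upperFn n (Group.nilpotencyClass (Delta G)) (Fin.last m) (Fin.last m)) •
          ((p ^ 1 : ℕ) : ZMod (p ^ n (Fin.last m))) = 0 := by
        refine (hnil.isUnit_one_sub.mul_left_eq_zero).1 ?_
        rw [← h1]
        simp only [nsmul_eq_mul]
        push_cast
        ring
      rw [pow_smul_pow_eq_zero_iff] at h2
      have huas := hG.uas_eq hn hn0 hι e hd
        (h2.trans (Nat.add_le_add_right (upperFn_le hn _ _ _) 1))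
      have hpm := natCast_prime_mem_radEnd hn hn0 e
      rw [← huas, mem_uas_radEnd_iff (e := e) hn hn0 hι] at hpm
      have h3 := hpm.2 ⟨i, u⟩ ⟨i, u⟩
      rw [AddMonoid.End.natCast_apply, map_nsmul, coord_gen_self, nsmul_one] at h3
      have h4 : p ^ upperFn n (Group.nilpotencyClass (Delta G)) i i •
          ((p ^ 1 : ℕ) : ZMod (p ^ n i)) = 0 := by rw [pow_one]; exact h3
      rw [pow_smul_pow_eq_zero_iff] at h4
      omega
    · have h1 := hent ⟨i, u⟩ ⟨i, u⟩
      rw [coord_sub_natCast_mul, transfer_gen_of_ne e hneq, map_zero, coord_gen_self, zero_sub,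
        smul_neg, neg_eq_zero, nsmul_one, nsmul_eq_mul p, ← Nat.cast_mul,
        pow_smul_natCast_eq_zero_iff, ← mul_assoc, ← pow_succ] at h1
      have h2 := (((hp.out.coprime_iff_not_dvd.2 hpk).pow_left (n i)).dvd_of_dvd_mul_right h1)
      have h3 := (Nat.pow_dvd_pow_iff_le_right hp.out.one_lt).1 h2
      dsimp only at h3
      omega
  · have hk : p ^ n i • (p ^ (n j - n i) • gen e ⟨j, v⟩) = 0 :=
      smul_pow_smul_gen e (by dsimp only; omega)
    have hneq : (⟨i, u⟩ : Σ i, ι i) ≠ ⟨j, v⟩ := fun h' => h (congrArg Sigma.fst h')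
    obtain ⟨k, hmem⟩ := hG.exists_sub_mem_uas hn hn0 hι e hd
      (transfer_mem_radEnd (x := ⟨i, u⟩) hn hn0 hk
        (by rw [radFn_eq hn, if_neg h]; dsimp only; omega))
    have h1 := ((mem_uas_radEnd_iff (e := e) hn hn0 hι _).1 hmem).2 ⟨i, u⟩ ⟨j, v⟩
    rw [coord_sub_natCast_mul, transfer_gen_self, map_nsmul, coord_gen_self,
      coord_gen_of_ne e hneq, smul_zero, smul_zero, sub_zero, nsmul_one,
      pow_smul_pow_eq_zero_iff] at h1
    dsimp only at h1
    rw [radFn_eq hn, if_neg h]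
    omega

/-- If there is only one cyclic summand of maximal order and `α(i, j, t) ≥ f_J(i, j)` away from
`(s, s)`, then the radical is `J_t` plus multiplications by multiples of `p`, the scalar being
the entry at the summand of maximal order. So `Δ(G) = (1 + J_t) Z` has class at most `t`. -/
theorem nilpotencyClass_le_of_radFn_le (hn : StrictMono n) (hn0 : 0 < n 0)
    (hι : ∀ i, Nonempty (ι i)) (e : G ≃+ (∀ i, ι i →₀ ZMod (p ^ n i)))
    [Subsingleton (ι (Fin.last m))] {t : ℕ} (ht : 1 ≤ t)
    (h : ∀ i j : Fin (m + 1), (i, j) ≠ (Fin.last m, Fin.last m) →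
      radFn n i j ≤ upperFn n t i j) :
    Group.nilpotencyClass (Delta G) ≤ t := by
  have := isNilpotent_Delta hn hn0 hι e
  rw [← Subgroup.upperCentralSeries_eq_top_iff_nilpotencyClass_le, eq_top_iff]
  intro g _
  apply gammaSet_subset_upperCentralSeries ht
  obtain ⟨w⟩ := hι (Fin.last m)
  have ha : ((g : (AddMonoid.End G)ˣ) : AddMonoid.End G) - 1 ∈ radEnd G := g.2
  set a := ((g : (AddMonoid.End G)ˣ) : AddMonoid.End G) - 1 with hadef
  obtain ⟨k, hk⟩ := prime_dvd_coord_of_mem_radEnd (e := e) hn hn0 ha ⟨Fin.last m, w⟩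
  have hc : (p : AddMonoid.End G) * k ∈ radEnd G :=
    TwoSidedIdeal.mul_mem_right _ _ _ (natCast_prime_mem_radEnd hn hn0 e)
  obtain ⟨z, hz⟩ := exists_onePlus_of_isNilpotent hc
    (isNilpotent_of_mem_entries_radFn hn hn0 ((mem_radEnd_iff (e := e) hn hn0).1 hc))
  have hb : a - (p : AddMonoid.End G) * k ∈ uas (radEnd G) t := by
    rw [mem_uas_radEnd_iff (e := e) hn hn0 hι]
    have hbJ := TwoSidedIdeal.sub_mem _ ha hc
    refine ⟨hbJ, ?_⟩
    rintro ⟨i, u⟩ ⟨j, v⟩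
    by_cases hij : (i, j) = (Fin.last m, Fin.last m)
    · rw [Prod.mk.injEq] at hij
      obtain ⟨rfl, rfl⟩ := hij
      rw [Subsingleton.elim u w, Subsingleton.elim v w, coord_sub_natCast_mul, coord_gen_self,
        ← mul_smul, nsmul_one, ← hk, ZMod.natCast_zmod_val, sub_self, smul_zero]
    · obtain ⟨d, hd⟩ := Nat.exists_eq_add_of_le (h i j hij)
      have h1 := (mem_radEnd_iff (e := e) hn hn0).1 hbJ ⟨i, u⟩ ⟨j, v⟩
      dsimp only at h1 ⊢
      rw [hd, pow_add, mul_comm, mul_smul, h1, smul_zero]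
  refine ⟨g * z⁻¹, z, ?_, ?_, by simp⟩
  · have h1 : (((g * z⁻¹ : Delta G) : (AddMonoid.End G)ˣ) : AddMonoid.End G) - 1 =
        (a - (p : AddMonoid.End G) * k) * (((z : (AddMonoid.End G)ˣ)⁻¹ : (AddMonoid.End G)ˣ) :
          AddMonoid.End G) := by
      have h2 : a - (p : AddMonoid.End G) * k = ((g : (AddMonoid.End G)ˣ) : AddMonoid.End G) -
          ((z : (AddMonoid.End G)ˣ) : AddMonoid.End G) := by
        rw [hz, hadef]
        abel
      rw [h2, sub_mul, Units.mul_inv]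
      simp
    rw [h1]
    exact TwoSidedIdeal.mul_mem_right _ _ _ hb
  · rw [hz]
    exact add_mem (one_mem _) (mul_mem (natCast_mem _ _) (natCast_mem _ _))

/-- For trivial `Δ(G)` the radical vanishes, so `p G = 0`; with rank one, `G` has order `p`. -/
theorem card_eq_of_nilpotencyClass_eq_zero (hn : StrictMono n) (hn0 : 0 < n 0)
    (hι : ∀ i, Nonempty (ι i)) (e : G ≃+ (∀ i, ι i →₀ ZMod (p ^ n i)))
    [Subsingleton (ι (Fin.last m))] (h : Group.nilpotencyClass (Delta G) = 0) :
    Nat.card G = p := by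
  have hp0 := radEnd_eq_bot_of_nilpotencyClass_eq_zero hn hn0 hι e h
    (natCast_prime_mem_radEnd hn hn0 e)
  obtain ⟨w⟩ := hι (Fin.last m)
  have h1 : p • gen e ⟨Fin.last m, w⟩ = 0 := DFunLike.congr_fun hp0 _
  have h2 := congrArg (coord e ⟨Fin.last m, w⟩) h1
  rw [map_nsmul, coord_gen_self, map_zero, nsmul_one, ZMod.natCast_eq_zero_iff] at h2
  have h3 : n (Fin.last m) ≤ 1 :=
    (Nat.pow_dvd_pow_iff_le_right hp.out.one_lt).1 (by simpa using h2)
  have hm : m = 0 := by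
    by_contra hm
    have := hn (show (0 : Fin (m + 1)) < Fin.last m from Fin.lt_def.2 (Nat.pos_of_ne_zero hm))
    omega
  subst hm
  have hn1 : n 0 = 1 := le_antisymm h3 hn0
  have : Subsingleton (ι 0) := ‹Subsingleton (ι (Fin.last 0))›
  rw [Nat.card_congr e.toEquiv, Nat.card_pi, Fin.prod_univ_succ, Fin.prod_univ_zero, mul_one,
    Nat.card_congr (Finsupp.uniqueEquiv (show ι 0 from w)), Nat.card_zmod, hn1, pow_one]

end Group

end UasUcs

theorem mainTheorem2 {p : ℕ} (hp : p.Prime) {m : ℕ} (n : Fin (m + 1) → ℕ)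
    (hn : StrictMono n) (hn0 : 0 < n 0)
    (ι : Fin (m + 1) → Type*) (hι : ∀ i, Nonempty (ι i))
    {G : Type*} [AddCommGroup G] (e : G ≃+ (∀ i, ι i →₀ ZMod (p ^ n i)))
    (hG : UasUcs.IsUasUcsGroup G) :
    Group.IsNilpotent (UasUcs.Delta G) ∧
    (2 ≤ Cardinal.mk (ι (Fin.last m)) →
      UasUcs.HasAnnihilatingLength (UasUcs.radEnd G)
        (Group.nilpotencyClass (UasUcs.Delta G))) ∧
    (Cardinal.mk (ι (Fin.last m)) = 1 → Nat.card G ≠ p →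
      UasUcs.IsY n (Group.nilpotencyClass (UasUcs.Delta G))) := by
  have : Fact p.Prime := ⟨hp⟩
  refine ⟨UasUcs.isNilpotent_Delta hn hn0 hι e, fun h2 => ?_, fun h1 hcard => ?_⟩
  · obtain ⟨u, v, huv⟩ := Cardinal.two_le_iff.1 h2
    exact hG.hasAnnihilatingLength hn hn0 hι e huv
  · have := (Cardinal.eq_one_iff_unique.1 h1).1
    have hd : 1 ≤ Group.nilpotencyClass (UasUcs.Delta G) :=
      Nat.one_le_iff_ne_zero.2 fun h0 =>
        hcard (UasUcs.card_eq_of_nilpotencyClass_eq_zero hn hn0 hι e h0)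
    exact ⟨⟨hd, fun i j hij => hG.radFn_le_upperFn hn hn0 hι e hd hij⟩,
      fun t ht => UasUcs.nilpotencyClass_le_of_radFn_le hn hn0 hι e ht.1 ht.2⟩
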